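/- Let $\hbar>0$ and let $\mu$ be a probability measure on $\mathbb R$ (the momentum-kick distribution; the case of a probability density $\tilde g$ is $d\mu=\tilde g(p)\,dp$). Put $g(\xi)=\int_{\mathbb R} e^{\frac{i}{\hbar}p\xi}\,d\mu(p)$ and let $$\Delta_g(\rho)=\int_{\mathbb R} e^{\frac{i}{\hbar}p\hat X}\,\rho\,e^{-\frac{i}{\hbar}p\hat X}\,d\mu(p)$$ (integral in the strong operator topology) be the random-kick dephasing channel on bounded operators on $L^2(\mathbb R)$, where $e^{\frac{i}{\hbar}p\hat X}$ is multiplication by $e^{\frac{i}{\hbar}px}$. A normal state is a positive trace-class operator on $L^2(\mathbb R)$ of trace one. For a Hilbert--Schmidt operator $\rho$ with Hilbert--Schmidt norm $\|\rho\|_2$ let $$C_2^g(\rho)=\|\rho\|_2^2-\|\Delta_g(\rho)\|_2^2 .$$ Every normal state is Hilbert--Schmidt, and for every Hilbert--Schmidt operator $\rho$ on $L^2(\mathbb R)$ (in particular for every normal state) $\Delta_g(\rho)$ is Hilbert--Schmidt and $\rho$ has an integral kernel $\rho(x,y)\in L^2(\mathbb R^2)$. Moreover: 1. For every Hilbert--Schmidt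 $\rho$ and every kernel $\rho(x,y)\in L^2(\mathbb R^2)$ of $\rho$, the function $(1-|g(x-y)|^2)|\rho(x,y)|^2$ is integrable on $\mathbb R^2$ and $$C_2^g(\rho)=\iint_{\mathbb R^2}\bigl(1-|g(x-y)|^2\bigr)\,|\rho(x,y)|^2\,dx\,dy .$$ 2. If $\mu$ is not a point mass at some $p_0\neq 0$ (in particular if $\mu$ has a density, or has mean zero), then for every Hilbert--Schmidt $\rho$ $$C_2^g(\rho)=0\iff \Delta_g(\rho)=\rho .$$ 3. If $|g(\xi)|<1$ for all $\xi\neq 0$, then $C_2^g(\rho)>0$ for every normal state $\rho$. -/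

import Mathlib

open MeasureTheory
open scoped ENNReal

noncomputable section

/-- The Hilbert space `L²(ℝ)` of complex wavefunctions on the line. -/
abbrev L2R : Type := Lp ℂ 2 (volume : Measure ℝ)

/-! ### Hilbert-Schmidt norm, trace, normal states -/

/-- The index set of a fixed Hilbert basis of `L²(ℝ)`. -/
def l2Index : Set L2R := Classical.choose (exists_hilbertBasis ℂ L2R)

/-- A fixed Hilbert basis of `L²(ℝ)`. It only serves to write down traces and Hilbert-Schmidt
norms, which do not depend on it: see `hsNormSq_eq` and `posTrace_eq`. -/
def l2Basis : HilbertBasis l2Index ℂ L2R :=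
  Classical.choose (Classical.choose_spec (exists_hilbertBasis ℂ L2R))

/-- The squared Hilbert-Schmidt norm `‖T‖₂² = ∑ ‖T eᵢ‖²`, with values in `[0, ∞]`. -/
def hsNormSq (T : L2R →L[ℂ] L2R) : ℝ≥0∞ := ∑' i, ‖T (l2Basis i)‖ₑ ^ 2

/-- `T` is a Hilbert-Schmidt operator. -/
def IsHilbertSchmidt (T : L2R →L[ℂ] L2R) : Prop := hsNormSq T ≠ ∞

/-- The trace `∑ ⟨eᵢ, T eᵢ⟩` of a positive operator `T`, with values in `[0, ∞]`. -/
def posTrace (T : L2R →L[ℂ] L2R) : ℝ≥0∞ :=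
  ∑' i, ENNReal.ofReal (RCLike.re (inner ℂ (l2Basis i) (T (l2Basis i))))

/-- A normal state (density operator) on `L²(ℝ)`: a positive trace-class operator of trace one. -/
structure IsNormalState (ρ : L2R →L[ℂ] L2R) : Prop where
  isPositive : ρ.IsPositive
  trace_eq_one : posTrace ρ = 1

theorem enorm_sq_eq_tsum {ι : Type*} (b : HilbertBasis ι ℂ L2R) (v : L2R) :
    ‖v‖ₑ ^ 2 = ∑' i, ‖inner ℂ (b i) v‖ₑ ^ 2 := by
  have h := b.hasSum_inner_mul_inner v v
  have h2 : HasSum (fun i => ‖inner ℂ (b i) v‖ ^ 2) (‖v‖ ^ 2) := by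
    have h3 := RCLike.hasSum_re (𝕜 := ℂ) h
    rw [inner_self_eq_norm_sq] at h3
    refine h3.congr_fun ?_ |> fun h => h
    intro i
    rw [inner_mul_symm_re_eq_norm, norm_mul, norm_inner_symm v, sq]
  have e : ∀ w : ℝ, ∀ _ : 0 ≤ w, ENNReal.ofReal (w ^ 2) = (ENNReal.ofReal w) ^ 2 :=
    fun w hw => ENNReal.ofReal_pow hw 2
  rw [← ofReal_norm, ← e _ (norm_nonneg _), ← h2.tsum_eq,
    ENNReal.ofReal_tsum_of_nonneg (fun i => by positivity) h2.summable]
  refine tsum_congr fun i => ?_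
  rw [e _ (norm_nonneg _), ofReal_norm]

theorem tsum_enorm_sq_adjoint {ι κ : Type*} (b : HilbertBasis ι ℂ L2R)
    (c : HilbertBasis κ ℂ L2R) (T : L2R →L[ℂ] L2R) :
    ∑' i, ‖T (b i)‖ₑ ^ 2 = ∑' j, ‖ContinuousLinearMap.adjoint T (c j)‖ₑ ^ 2 := by
  simp_rw [fun i => enorm_sq_eq_tsum c (T (b i)),
    fun j => enorm_sq_eq_tsum b (ContinuousLinearMap.adjoint T (c j))]
  rw [ENNReal.tsum_comm]
  refine tsum_congr fun j => tsum_congr fun i => ?_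
  rw [ContinuousLinearMap.adjoint_inner_right, ← ofReal_norm, ← ofReal_norm, norm_inner_symm]

/-- The Hilbert-Schmidt norm does not depend on the Hilbert basis. -/
theorem hsNormSq_eq {ι : Type*} (b : HilbertBasis ι ℂ L2R) (T : L2R →L[ℂ] L2R) :
    hsNormSq T = ∑' i, ‖T (b i)‖ₑ ^ 2 := by
  rw [hsNormSq, tsum_enorm_sq_adjoint l2Basis l2Basis, ← tsum_enorm_sq_adjoint b l2Basis]

theorem exists_adjoint_eq_self_mul_self {H : Type*} [NormedAddCommGroup H]
    [InnerProductSpace ℂ H] [CompleteSpace H] (T : H →L[ℂ] H) (hT : T.IsPositive) :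
    ∃ S : H →L[ℂ] H, ContinuousLinearMap.adjoint S = S ∧ S * S = T := by
  have hT0 : 0 ≤ T := (ContinuousLinearMap.nonneg_iff_isPositive T).2 hT
  exact ⟨CFC.sqrt T, (IsSelfAdjoint.of_nonneg (CFC.sqrt_nonneg T)).star_eq,
    CFC.sqrt_mul_sqrt_self T⟩

/-- The trace of a positive operator does not depend on the Hilbert basis. -/
theorem posTrace_eq {ι : Type*} (b : HilbertBasis ι ℂ L2R) (T : L2R →L[ℂ] L2R)
    (hT : T.IsPositive) :
    posTrace T = ∑' i, ENNReal.ofReal (RCLike.re (inner ℂ (b i) (T (b i)))) := by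
  obtain ⟨S, hS, hSS⟩ := exists_adjoint_eq_self_mul_self T hT
  have key : ∀ v : L2R, ENNReal.ofReal (RCLike.re (inner ℂ v (T v))) = ‖S v‖ₑ ^ 2 := by
    intro v
    have : inner ℂ v (T v) = inner ℂ (S v) (S v) := by
      rw [← hSS, ← ContinuousLinearMap.adjoint_inner_right, hS]; rfl
    rw [this, inner_self_eq_norm_sq, ENNReal.ofReal_pow (norm_nonneg _), ofReal_norm]
  simp_rw [posTrace, key]
  exact hsNormSq_eq b S

/-- `k` is the position kernel `k(x, y) = ⟨x|T|y⟩` of the Hilbert-Schmidt operator `T`: it is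
square integrable on `ℝ²` and `(T f)(x) = ∫ k(x, y) f(y) dy`. -/
structure IsHSKernel (T : L2R →L[ℂ] L2R) (k : ℝ × ℝ → ℂ) : Prop where
  memLp : MemLp k 2 (volume : Measure (ℝ × ℝ))
  apply_ae : ∀ f : L2R, (T f : ℝ → ℂ) =ᵐ[volume] fun x => ∫ y, k (x, y) * f y

/-! ### The random-kick dephasing channel -/

/-- The phase `exp(i p x / ħ)`. -/
def kickPhase (ħ p x : ℝ) : ℂ := Complex.exp (((p * x / ħ : ℝ) : ℂ) * Complex.I)

theorem norm_kickPhase (ħ p x : ℝ) : ‖kickPhase ħ p x‖ = 1 := Complex.norm_exp_ofReal_mul_I _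

theorem continuous_kickPhase (ħ p : ℝ) : Continuous (kickPhase ħ p) := by
  unfold kickPhase; fun_prop

theorem continuous_kickPhase_left (ħ x : ℝ) : Continuous fun p => kickPhase ħ p x := by
  unfold kickPhase; fun_prop

theorem memLp_kickPhase_mul (ħ p : ℝ) (f : L2R) :
    MemLp (fun x => kickPhase ħ p x * f x) 2 (volume : Measure ℝ) :=
  (Lp.memLp f).of_le ((continuous_kickPhase ħ p).aestronglyMeasurable.mul
    (Lp.aestronglyMeasurable f)) (.of_forall fun x => by simp [norm_kickPhase])

theorem norm_kickPhase_mul_toLp (ħ p : ℝ) (f : L2R) :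
    ‖(memLp_kickPhase_mul ħ p f).toLp‖ = ‖f‖ := by
  rw [Lp.norm_toLp, Lp.norm_def]
  congr 1
  exact eLpNorm_congr_norm_ae (.of_forall fun x => by simp [norm_kickPhase])

/-- The momentum kick `exp(i p X / ħ)`, i.e. multiplication by `exp(i p x / ħ)`,
on `L²(ℝ)`. -/
def kick (ħ p : ℝ) : L2R →L[ℂ] L2R :=
  LinearMap.mkContinuous
    { toFun := fun f => (memLp_kickPhase_mul ħ p f).toLp
      map_add' := fun f h => by
        rw [← MemLp.toLp_add, MemLp.toLp_eq_toLp_iff]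
        filter_upwards [Lp.coeFn_add f h] with x hx
        rw [hx, Pi.add_apply, mul_add]
        rfl
      map_smul' := fun c f => by
        rw [RingHom.id_apply, ← MemLp.toLp_const_smul, MemLp.toLp_eq_toLp_iff]
        filter_upwards [Lp.coeFn_smul c f] with x hx
        simp only [hx, Pi.smul_apply, smul_eq_mul]
        ring }
    1 (fun f => by
      rw [one_mul]
      exact (norm_kickPhase_mul_toLp ħ p f).le)

theorem kick_apply (ħ p : ℝ) (f : L2R) : kick ħ p f = (memLp_kickPhase_mul ħ p f).toLp := rfl

theorem coeFn_kick (ħ p : ℝ) (f : L2R) :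
    (kick ħ p f : ℝ → ℂ) =ᵐ[volume] fun x => kickPhase ħ p x * f x := by
  rw [kick_apply]; exact MemLp.coeFn_toLp _

theorem norm_kick_apply (ħ p : ℝ) (f : L2R) : ‖kick ħ p f‖ = ‖f‖ := norm_kickPhase_mul_toLp ħ p f

theorem continuous_kick_apply (ħ : ℝ) (f : L2R) : Continuous fun p => kick ħ p f := by
  rw [continuous_iff_continuousAt]
  intro q
  have hint : Integrable (fun x => ‖f x‖ ^ 2) (volume : Measure ℝ) :=
    (Lp.memLp f).integrable_norm_pow (by norm_num)
  have h1 : Continuous fun p => inner ℂ (kick ħ q f) (kick ħ p f) := by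
    have : (fun p => inner ℂ (kick ħ q f) (kick ħ p f)) = fun p => ∫ x,
        inner ℂ (kickPhase ħ q x * f x) (kickPhase ħ p x * f x) := by
      funext p
      rw [L2.inner_def]
      refine integral_congr_ae ?_
      filter_upwards [coeFn_kick ħ q f, coeFn_kick ħ p f] with x h1 h2
      rw [h1, h2]
    rw [this]
    refine continuous_of_dominated (bound := fun x => ‖f x‖ ^ 2) ?_ ?_ hint ?_
    · intro p
      exact (memLp_kickPhase_mul ħ q f).1.inner (memLp_kickPhase_mul ħ p f).1
    · intro p
      refine .of_forall fun x => (norm_inner_le_norm _ _).trans ?_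
      simp [norm_kickPhase, sq]
    · refine .of_forall fun x => ?_
      exact continuous_const.inner ((continuous_kickPhase_left ħ x).mul continuous_const)
  have h2 : ∀ p, ‖kick ħ p f - kick ħ q f‖ ^ 2
      = 2 * ‖f‖ ^ 2 - 2 * RCLike.re (inner ℂ (kick ħ q f) (kick ħ p f)) := by
    intro p
    rw [norm_sub_rev, norm_sub_sq (𝕜 := ℂ), norm_kick_apply, norm_kick_apply]
    ring
  have h3 : Filter.Tendsto (fun p => ‖kick ħ p f - kick ħ q f‖ ^ 2) (nhds q) (nhds 0) := by
    have hc : Continuous fun p => ‖kick ħ p f - kick ħ q f‖ ^ 2 := by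
      simp_rw [h2]
      exact continuous_const.sub (continuous_const.mul (RCLike.continuous_re.comp h1))
    have := hc.tendsto q
    simpa using this
  rw [ContinuousAt, tendsto_iff_norm_sub_tendsto_zero]
  have h4 := h3.sqrt
  simpa [Real.sqrt_sq (norm_nonneg _)] using h4

theorem continuous_kick_conj (ħ : ℝ) (ρ : L2R →L[ℂ] L2R) (f : L2R) :
    Continuous fun p => kick ħ p (ρ (kick ħ (-p) f)) := by
  have hv : Continuous fun p => ρ (kick ħ (-p) f) :=
    ρ.continuous.comp ((continuous_kick_apply ħ f).comp continuous_neg)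
  rw [continuous_iff_continuousAt]
  intro q
  rw [ContinuousAt, tendsto_iff_norm_sub_tendsto_zero]
  have h1 := tendsto_iff_norm_sub_tendsto_zero.1 (hv.tendsto q)
  have h2 := tendsto_iff_norm_sub_tendsto_zero.1
    ((continuous_kick_apply ħ (ρ (kick ħ (-q) f))).tendsto q)
  refine squeeze_zero (fun _ => norm_nonneg _) (fun p => ?_) (by simpa using h1.add h2)
  calc _ = ‖kick ħ p (ρ (kick ħ (-p) f) - ρ (kick ħ (-q) f))
          + (kick ħ p (ρ (kick ħ (-q) f)) - kick ħ q (ρ (kick ħ (-q) f)))‖ := by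
        rw [map_sub]; congr 1; abel
    _ ≤ _ := (norm_add_le _ _).trans (by rw [norm_kick_apply])

theorem norm_kick_conj_le (ħ p : ℝ) (ρ : L2R →L[ℂ] L2R) (f : L2R) :
    ‖kick ħ p (ρ (kick ħ (-p) f))‖ ≤ ‖ρ‖ * ‖f‖ := by
  rw [norm_kick_apply]
  exact (ρ.le_opNorm _).trans (by rw [norm_kick_apply])

theorem integrable_kick_conj (ħ : ℝ) (μ : Measure ℝ) [IsProbabilityMeasure μ]
    (ρ : L2R →L[ℂ] L2R) (f : L2R) :
    Integrable (fun p => kick ħ p (ρ (kick ħ (-p) f))) μ :=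
  .of_bound (continuous_kick_conj ħ ρ f).aestronglyMeasurable (‖ρ‖ * ‖f‖)
    (.of_forall fun p => norm_kick_conj_le ħ p ρ f)

/-- The random-kick dephasing channel `Δ_g(ρ) = ∫ exp(i p X / ħ) ρ exp(-i p X / ħ) dμ(p)` with
momentum-kick distribution `μ`, for an arbitrary bounded operator `ρ`. The integral converges
in the strong operator topology. -/
def dephasing (ħ : ℝ) (μ : Measure ℝ) [IsProbabilityMeasure μ] (ρ : L2R →L[ℂ] L2R) :
    L2R →L[ℂ] L2R :=
  LinearMap.mkContinuous
    { toFun := fun f => ∫ p, kick ħ p (ρ (kick ħ (-p) f)) ∂μ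
      map_add' := fun f h => by
        simp only [map_add]
        exact integral_add (integrable_kick_conj ħ μ ρ f) (integrable_kick_conj ħ μ ρ h)
      map_smul' := fun c f => by
        simp only [map_smul, RingHom.id_apply]
        exact integral_smul c _ }
    ‖ρ‖ (fun f => by
      refine (norm_integral_le_of_norm_le_const
        (.of_forall fun p => norm_kick_conj_le ħ p ρ f)).trans ?_
      simp)

/-- The dephasing function `g(ξ) = ∫ exp(i p ξ / ħ) dμ(p)`. -/
def dephasingKernel (ħ : ℝ) (μ : Measure ℝ) (ξ : ℝ) : ℂ := ∫ p, kickPhase ħ p ξ ∂μ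

/-- A kick distribution with a probability density is not a point mass. -/
theorem ne_dirac_of_absolutelyContinuous (μ : Measure ℝ) (hμ : μ ≪ volume) (p : ℝ) :
    μ ≠ Measure.dirac p := by
  rintro rfl
  have h := hμ (Real.volume_singleton (a := p))
  simp at h

/-- The `l₂` dephasing loss `C₂^g(ρ) = ‖ρ‖₂² - ‖Δ_g(ρ)‖₂²`. -/
def l2DephasingLoss (ħ : ℝ) (μ : Measure ℝ) [IsProbabilityMeasure μ] (ρ : L2R →L[ℂ] L2R) : ℝ :=
  (hsNormSq ρ).toReal - (hsNormSq (dephasing ħ μ ρ)).toReal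

end

open scoped ComplexConjugate

/-! Everything is read off the position kernel. The squared Hilbert-Schmidt norm of an operator is
the squared `L²(ℝ²)` norm of its kernel (`IsHSKernel.hsNormSq_eq_lintegral`), and conjugation by a
kick multiplies the kernel by the phase `exp(i p (x - y) / ħ)`, so averaging over `μ` multiplies it
by `g(x - y)` (`IsHSKernel.dephasing`). Subtracting the two norms gives the integral formula.

Since `|g| ≤ 1`, the integrand is nonnegative, and zero loss forces the kernel to vanish almost
everywhere off the strip `|g(x - y)| = 1`. If `μ` is not a point mass, `|g(ξ)| = 1` makes the phase
constant on the support of `μ`; two support points `p ≠ q` then confine `ξ` to the lattice `(2πħ /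
(p - q)) ℤ`. The strip over a countable set is null, so zero loss means `ρ = 0`. Among point masses
only the one at `0` remains to be treated, and there the channel is the identity. For normal states,
`|g| < 1` off `0` makes the strip the diagonal, and trace one excludes `ρ = 0`. -/

theorem countable_of_hilbertBasis {ι E : Type*} [NormedAddCommGroup E] [InnerProductSpace ℂ E]
    [TopologicalSpace.SeparableSpace E] (b : HilbertBasis ι ℂ E) : Countable ι := by
  -- Distinct basis vectors are at distance `√2`, so balls of radius `1/2` around them are disjoint.
  refine Pairwise.countable_of_isOpen_disjoint (s := fun i => Metric.ball (b i) (1 / 2))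
    (fun i j hij => ?_) (fun i => Metric.isOpen_ball)
    (fun i => ⟨b i, Metric.mem_ball_self (by norm_num)⟩)
  refine Metric.ball_disjoint_ball ?_
  have h : ‖b i - b j‖ ^ 2 = 2 := by
    rw [norm_sub_sq (𝕜 := ℂ), b.orthonormal.2 hij, b.orthonormal.1, b.orthonormal.1]
    norm_num
  rw [dist_eq_norm]
  nlinarith [norm_nonneg (b i - b j)]

/-! ### Hilbert-Schmidt operators and their kernels -/

/-- The function `(x, y) ↦ g(x) conj(h(y))` is square integrable on the plane. -/
theorem memLp_tensorConj (g h : L2R) :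
    MemLp (fun z : ℝ × ℝ => g z.1 * conj (h z.2)) 2 (volume : Measure (ℝ × ℝ)) := by
  have hm : AEStronglyMeasurable (fun z : ℝ × ℝ => g z.1 * conj (h z.2))
      (volume : Measure (ℝ × ℝ)) :=
    (Lp.aestronglyMeasurable g).comp_fst.mul
      (Complex.continuous_conj.comp_aestronglyMeasurable (Lp.aestronglyMeasurable h).comp_snd)
  rw [memLp_two_iff_integrable_sq_norm hm]
  have := ((Lp.memLp g).integrable_norm_pow (by norm_num)).mul_prod
    ((Lp.memLp h).integrable_norm_pow (by norm_num))
  simpa only [norm_mul, mul_pow, RCLike.norm_conj, Measure.volume_eq_prod] using this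

/-- The element `(x, y) ↦ g(x) conj(h(y))` of `L²(ℝ²)`, the kernel of `f ↦ ⟨h, f⟩ g`. -/
noncomputable def tensorConj (g h : L2R) : Lp ℂ 2 (volume : Measure (ℝ × ℝ)) :=
  (memLp_tensorConj g h).toLp

theorem coeFn_tensorConj (g h : L2R) :
    (tensorConj g h : ℝ × ℝ → ℂ) =ᵐ[volume] fun z => g z.1 * conj (h z.2) :=
  MemLp.coeFn_toLp _

theorem inner_tensorConj_eq_integral (g h : L2R) (k : Lp ℂ 2 (volume : Measure (ℝ × ℝ))) :
    inner ℂ (tensorConj g h) k = ∫ z : ℝ × ℝ, k z * (conj (g z.1) * h z.2) := by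
  rw [L2.inner_def]
  refine integral_congr_ae ?_
  filter_upwards [coeFn_tensorConj g h] with z hz
  simp [hz, RCLike.inner_apply]

theorem inner_eq_integral_mul (g h : L2R) : inner ℂ g h = ∫ x, conj (g x) * h x := by
  rw [L2.inner_def]
  simp [RCLike.inner_apply, mul_comm]

theorem inner_tensorConj (g h g' h' : L2R) :
    inner ℂ (tensorConj g h) (tensorConj g' h') = inner ℂ g g' * inner ℂ h' h := by
  rw [inner_tensorConj_eq_integral, inner_eq_integral_mul, inner_eq_integral_mul,
    ← integral_prod_mul]
  refine integral_congr_ae ?_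
  filter_upwards [coeFn_tensorConj g' h'] with z hz
  rw [hz]; ring

theorem integrable_mul_tensor {k : ℝ × ℝ → ℂ} (hk : MemLp k 2 volume) (g f : L2R) :
    Integrable (fun z : ℝ × ℝ => k z * (conj (g z.1) * f z.2)) volume := by
  have := hk.integrable_mul (memLp_tensorConj g f).star
  simpa [Pi.mul_def, mul_comm, mul_left_comm] using this

/-- The operator with kernel `k` is determined by its matrix elements. -/
theorem IsHSKernel.inner_eq {T : L2R →L[ℂ] L2R} {k : ℝ × ℝ → ℂ} (hk : IsHSKernel T k)
    (g f : L2R) : inner ℂ g (T f) = ∫ z : ℝ × ℝ, k z * (conj (g z.1) * f z.2) := by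
  rw [inner_eq_integral_mul, Measure.volume_eq_prod,
    integral_prod _ (integrable_mul_tensor hk.memLp g f)]
  refine integral_congr_ae ?_
  filter_upwards [hk.apply_ae f] with x hx
  rw [hx, ← integral_const_mul]
  refine integral_congr_ae (.of_forall fun y => ?_)
  simp only
  ring

/-- Testing against indicators of sets of finite measure turns the matrix elements into set
integrals, and these determine `T f` almost everywhere. Convergent sums and averages of operators
are easier to handle through matrix elements than pointwise. -/
theorem isHSKernel_of_inner_eq {T : L2R →L[ℂ] L2R} {k : ℝ × ℝ → ℂ} (hk : MemLp k 2 volume)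
    (h : ∀ g f : L2R, inner ℂ g (T f) = ∫ z : ℝ × ℝ, k z * (conj (g z.1) * f z.2)) :
    IsHSKernel T k := by
  refine ⟨hk, fun f => ?_⟩
  have key : ∀ s, MeasurableSet s → volume s < ∞ →
      IntegrableOn (fun z : ℝ × ℝ => k z * f z.2) (s ×ˢ Set.univ) volume := by
    intro s hs hμ
    have h1 := integrable_mul_tensor hk (indicatorConstLp 2 hs hμ.ne (1 : ℂ)) f
    rw [← integrable_indicator_iff (hs.prod .univ)]
    refine h1.congr ?_
    have h2 : ∀ᵐ z : ℝ × ℝ, indicatorConstLp 2 hs hμ.ne (1 : ℂ) z.1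
        = s.indicator (fun _ => (1 : ℂ)) z.1 :=
      Measure.quasiMeasurePreserving_fst.ae (indicatorConstLp_coeFn (p := 2) (hs := hs))
    filter_upwards [h2] with z hz
    rw [hz]
    by_cases h : z.1 ∈ s <;> simp [h]
  refine ae_eq_of_forall_setIntegral_eq_of_sigmaFinite ?_ ?_ ?_
  · intro s hs hμ
    exact integrableOn_Lp_of_measure_ne_top (T f) (by norm_num) hμ.ne
  · intro s hs hμ
    have := key s hs hμ
    rw [IntegrableOn, Measure.volume_eq_prod, ← Measure.prod_restrict, Measure.restrict_univ] at this
    exact this.integral_prod_left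
  · intro s hs hμ
    have h1 := h (indicatorConstLp 2 hs hμ.ne (1 : ℂ)) f
    rw [L2.inner_indicatorConstLp_one] at h1
    have h3 := key s hs hμ
    rw [IntegrableOn, Measure.volume_eq_prod, ← Measure.prod_restrict, Measure.restrict_univ] at h3
    rw [h1, ← integral_prod _ h3]
    have : (volume.restrict s).prod (volume : Measure ℝ)
      = (volume : Measure (ℝ × ℝ)).restrict (s ×ˢ Set.univ) := by
      rw [Measure.volume_eq_prod, ← Measure.prod_restrict, Measure.restrict_univ]
    rw [this, ← integral_indicator (hs.prod .univ)]
    have h2 : ∀ᵐ z : ℝ × ℝ, indicatorConstLp 2 hs hμ.ne (1 : ℂ) z.1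
        = s.indicator (fun _ => (1 : ℂ)) z.1 :=
      Measure.quasiMeasurePreserving_fst.ae (indicatorConstLp_coeFn (p := 2) (hs := hs))
    refine integral_congr_ae ?_
    filter_upwards [h2] with z hz
    rw [hz]
    by_cases h : z.1 ∈ s <;> simp [h]

/-- A Hilbert-Schmidt operator has a square integrable kernel. -/
theorem IsHilbertSchmidt.exists_isHSKernel {T : L2R →L[ℂ] L2R} (hT : IsHilbertSchmidt T) :
    ∃ k : ℝ × ℝ → ℂ, IsHSKernel T k := by
  -- `F i` is the kernel of the rank-one piece `f ↦ ⟨eᵢ, f⟩ T eᵢ`. These kernels are orthogonal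
  -- because the `eᵢ` are, and their squared norms sum to `‖T‖₂²`, so the series converges in
  -- `L²(ℝ²)`.
  set F : l2Index → Lp ℂ 2 (volume : Measure (ℝ × ℝ)) :=
    fun i => tensorConj (T (l2Basis i)) (l2Basis i) with hF
  have hFn : ∀ i, ‖F i‖ ^ 2 = ‖T (l2Basis i)‖ ^ 2 := fun i => by
    have h := inner_tensorConj (T (l2Basis i)) (l2Basis i) (T (l2Basis i)) (l2Basis i)
    rw [inner_self_eq_norm_sq_to_K, inner_self_eq_norm_sq_to_K, inner_self_eq_norm_sq_to_K,
      l2Basis.orthonormal.1] at h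
    rw [RCLike.ofReal_one, one_pow, mul_one] at h
    exact_mod_cast h
  have hs : Summable fun i => ‖F i‖ ^ 2 := by
    have h := ENNReal.summable_toReal hT
    simp_rw [hFn]
    simpa using h
  have hO : OrthogonalFamily ℂ (fun i => Submodule.span ℂ {F i})
      fun i => (Submodule.span ℂ {F i}).subtypeₗᵢ := by
    refine OrthogonalFamily.of_pairwise fun i j hij => ?_
    refine Submodule.isOrtho_span.2 ?_
    rintro _ rfl _ rfl
    rw [hF, inner_tensorConj, l2Basis.orthonormal.2 hij.symm, mul_zero]
  have hsum : Summable F :=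
    (hO.summable_iff_norm_sq_summable
      (fun i => ⟨F i, Submodule.mem_span_singleton_self _⟩)).2 hs
  refine ⟨(∑' i, F i : Lp ℂ 2 (volume : Measure (ℝ × ℝ))),
    isHSKernel_of_inner_eq (Lp.memLp _) fun g f => ?_⟩
  rw [← inner_tensorConj_eq_integral]
  have h1 := hsum.hasSum.mapL (innerSL ℂ (tensorConj g f))
  have h2 := ((l2Basis.hasSum_repr f).mapL T).mapL (innerSL ℂ g)
  refine h2.unique ?_
  refine h1.congr_fun ?_ |> fun h => h
  intro i
  simp [hF, inner_tensorConj, HilbertBasis.repr_apply_apply, mul_comm]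


theorem sq_eLpNorm_two {α E : Type*} [MeasurableSpace α] [NormedAddCommGroup E] (ν : Measure α)
    (f : α → E) : eLpNorm f 2 ν ^ 2 = ∫⁻ x, ‖f x‖ₑ ^ 2 ∂ν := by
  have h := eLpNorm_nnreal_pow_eq_lintegral (μ := ν) (f := f) (p := 2) two_ne_zero
  simpa using h

/-- The Hilbert-Schmidt norm is the `L²` norm of the kernel. -/
theorem IsHSKernel.hsNormSq_eq_lintegral {T : L2R →L[ℂ] L2R} {k : ℝ × ℝ → ℂ}
    (hk : IsHSKernel T k) : hsNormSq T = ∫⁻ z : ℝ × ℝ, ‖k z‖ₑ ^ 2 := by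
  have : Fact ((2 : ℝ≥0∞) ≠ ∞) := ⟨by norm_num⟩
  have : Countable l2Index := countable_of_hilbertBasis l2Basis
  -- Countability of the basis gives one null set that serves all `i`.
  have hT : ∀ᵐ x : ℝ, ∀ i, (T (l2Basis i) : ℝ → ℂ) x = ∫ y, k (x, y) * l2Basis i y :=
    ae_all_iff.2 fun i => hk.apply_ae _
  have hn : ∀ v : L2R, ‖v‖ₑ ^ 2 = ∫⁻ x, ‖v x‖ₑ ^ 2 := fun v => by
    rw [Lp.enorm_def, sq_eLpNorm_two]
  have hsec : ∀ᵐ x : ℝ, MemLp (fun y => k (x, y)) 2 volume := by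
    have h1 : Integrable (fun z : ℝ × ℝ => ‖k z‖ ^ 2) (volume.prod volume) :=
      hk.memLp.integrable_norm_pow (by norm_num)
    have h2 : AEStronglyMeasurable k (volume.prod volume) := hk.memLp.1
    filter_upwards [h1.prod_right_ae, h2.prodMk_left] with x h3 h4
    exact (memLp_two_iff_integrable_sq_norm h4).2 h3
  have hm : AEMeasurable (fun z : ℝ × ℝ => ‖k z‖ₑ ^ 2) (volume.prod volume) :=
    hk.memLp.1.enorm.pow_const 2
  simp_rw [hsNormSq, hn]
  rw [← lintegral_tsum fun i => (Lp.aestronglyMeasurable _).enorm.pow_const 2,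
    Measure.volume_eq_prod, lintegral_prod _ hm]
  refine lintegral_congr_ae ?_
  filter_upwards [hT, hsec] with x hx hs
  -- `(T eᵢ)(x)` is the inner product of the conjugated section `conj k(x, ·)` with `eᵢ`, so
  -- Parseval applies in `y` for almost every `x`.
  have hv : ∫⁻ y, ‖k (x, y)‖ₑ ^ 2 = ‖hs.star.toLp‖ₑ ^ 2 := by
    rw [hn]
    refine lintegral_congr_ae ?_
    filter_upwards [hs.star.coeFn_toLp] with y hy
    simp [hy]
  rw [hv, enorm_sq_eq_tsum l2Basis]
  refine tsum_congr fun i => ?_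
  rw [hx, ← ofReal_norm (inner ℂ _ _), norm_inner_symm, ofReal_norm, L2.inner_def]
  congr 2
  refine integral_congr_ae ?_
  filter_upwards [hs.star.coeFn_toLp] with y hy
  simp [hy, RCLike.inner_apply, mul_comm]

theorem IsHSKernel.eq_zero {T : L2R →L[ℂ] L2R} {k : ℝ × ℝ → ℂ} (hk : IsHSKernel T k)
    (h0 : k =ᵐ[volume] 0) : T = 0 := by
  ext1 f
  refine ext_inner_left ℂ fun g => ?_
  rw [hk.inner_eq, zero_apply, inner_zero_right]
  refine integral_eq_zero_of_ae ?_
  filter_upwards [h0] with z hz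
  simp [hz]

/-! ### Normal states -/

/-- A normal state is a Hilbert-Schmidt operator. -/
theorem IsNormalState.isHilbertSchmidt {ρ : L2R →L[ℂ] L2R} (hρ : IsNormalState ρ) :
    IsHilbertSchmidt ρ := by
  -- With `ρ = S²` and `S` self-adjoint, the trace of `ρ` is `‖S‖₂²`, and `‖S S eᵢ‖ ≤ ‖S‖ ‖S eᵢ‖`.
  obtain ⟨S, hS, rfl⟩ := exists_adjoint_eq_self_mul_self ρ hρ.isPositive
  have key : ∀ v : L2R, ENNReal.ofReal (RCLike.re (inner ℂ v ((S * S) v))) = ‖S v‖ₑ ^ 2 := by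
    intro v
    have : inner ℂ v ((S * S) v) = inner ℂ (S v) (S v) := by
      rw [← ContinuousLinearMap.adjoint_inner_right, hS]; rfl
    rw [this, inner_self_eq_norm_sq, ENNReal.ofReal_pow (norm_nonneg _), ofReal_norm]
  have h1 : hsNormSq S = 1 := by
    rw [← hρ.trace_eq_one, posTrace]
    simp_rw [key]
    rfl
  have h2 : hsNormSq (S * S) ≤ ‖S‖ₑ ^ 2 * hsNormSq S := by
    rw [hsNormSq, hsNormSq, ← ENNReal.tsum_mul_left]
    refine ENNReal.tsum_le_tsum fun i => ?_
    rw [← mul_pow]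
    gcongr
    exact S.le_opENorm _
  refine ne_top_of_le_ne_top ?_ h2
  rw [h1, mul_one]
  finiteness

theorem IsNormalState.ne_zero {ρ : L2R →L[ℂ] L2R} (hρ : IsNormalState ρ) : ρ ≠ 0 := by
  rintro rfl
  have := hρ.trace_eq_one
  simp [posTrace] at this

/-! ### The channel on kernels and the integral formula -/

theorem kickPhase_neg (ħ p x : ℝ) : kickPhase ħ (-p) x = conj (kickPhase ħ p x) := by
  rw [kickPhase, kickPhase, ← Complex.exp_conj]
  simp [neg_div]

theorem kickPhase_sub (ħ p x y : ℝ) :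
    kickPhase ħ p (x - y) = kickPhase ħ p x * kickPhase ħ (-p) y := by
  rw [kickPhase, kickPhase, kickPhase, ← Complex.exp_add]
  congr 1
  push_cast
  ring

theorem continuous_kickPhase_uncurry (ħ : ℝ) :
    Continuous fun q : ℝ × ℝ => kickPhase ħ q.1 q.2 := by
  unfold kickPhase; fun_prop

theorem inner_kick (ħ p : ℝ) (g f : L2R) :
    inner ℂ g (kick ħ p f) = inner ℂ (kick ħ (-p) g) f := by
  rw [L2.inner_def, L2.inner_def]
  refine integral_congr_ae ?_
  filter_upwards [coeFn_kick ħ p f, coeFn_kick ħ (-p) g] with x h1 h2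
  rw [h1, h2, kickPhase_neg]
  simp [RCLike.inner_apply]
  ring

theorem dephasing_apply (ħ : ℝ) (μ : Measure ℝ) [IsProbabilityMeasure μ] (ρ : L2R →L[ℂ] L2R)
    (f : L2R) : dephasing ħ μ ρ f = ∫ p, kick ħ p (ρ (kick ħ (-p) f)) ∂μ := rfl

theorem norm_dephasingKernel_le (ħ : ℝ) (μ : Measure ℝ) [IsProbabilityMeasure μ] (ξ : ℝ) :
    ‖dephasingKernel ħ μ ξ‖ ≤ 1 := by
  refine (norm_integral_le_of_norm_le_const (C := 1)
    (.of_forall fun p => (norm_kickPhase ħ p ξ).le)).trans ?_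
  simp

theorem continuous_dephasingKernel (ħ : ℝ) (μ : Measure ℝ) [IsProbabilityMeasure μ] :
    Continuous (dephasingKernel ħ μ) := by
  unfold dephasingKernel
  refine continuous_of_dominated (bound := fun _ => 1)
    (fun ξ => (continuous_kickPhase_left ħ ξ).aestronglyMeasurable)
    (fun ξ => .of_forall fun p => (norm_kickPhase ħ p ξ).le) (integrable_const _)
    (.of_forall fun p => continuous_kickPhase ħ p)

/-- Dephasing multiplies the kernel by `g(x - y)`. -/
theorem IsHSKernel.dephasing {ħ : ℝ} {μ : Measure ℝ} [IsProbabilityMeasure μ]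
    {ρ : L2R →L[ℂ] L2R} {k : ℝ × ℝ → ℂ} (hk : IsHSKernel ρ k) :
    IsHSKernel (dephasing ħ μ ρ) fun z => dephasingKernel ħ μ (z.1 - z.2) * k z := by
  have hg : Continuous fun z : ℝ × ℝ => dephasingKernel ħ μ (z.1 - z.2) :=
    (continuous_dephasingKernel ħ μ).comp (by fun_prop)
  refine isHSKernel_of_inner_eq (hk.memLp.of_le (hg.aestronglyMeasurable.mul hk.memLp.1)
    (.of_forall fun z => ?_)) fun g f => ?_
  · rw [norm_mul]
    exact mul_le_of_le_one_left (norm_nonneg _) (norm_dephasingKernel_le ħ μ _)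
  · have h1 : ∀ p, inner ℂ g (kick ħ p (ρ (kick ħ (-p) f)))
        = ∫ z : ℝ × ℝ, kickPhase ħ p (z.1 - z.2) * (k z * (conj (g z.1) * f z.2)) := by
      intro p
      rw [inner_kick, hk.inner_eq]
      refine integral_congr_ae ?_
      have ha : ∀ᵐ z : ℝ × ℝ, kick ħ (-p) g z.1 = kickPhase ħ (-p) z.1 * g z.1 :=
        Measure.quasiMeasurePreserving_fst.ae (coeFn_kick ħ (-p) g)
      have hb : ∀ᵐ z : ℝ × ℝ, kick ħ (-p) f z.2 = kickPhase ħ (-p) z.2 * f z.2 :=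
        Measure.quasiMeasurePreserving_snd.ae (coeFn_kick ħ (-p) f)
      filter_upwards [ha, hb] with z h2 h3
      rw [h2, h3, kickPhase_sub, map_mul, ← kickPhase_neg, neg_neg]
      ring
    rw [dephasing_apply, ← integral_inner (integrable_kick_conj ħ μ ρ f)]
    simp_rw [h1]
    have hF := integrable_mul_tensor hk.memLp g f
    -- Fubini is allowed because the phase is unimodular, `μ` is finite and the remaining factor is
    -- integrable on the plane.
    rw [integral_integral_swap]
    · refine integral_congr_ae (.of_forall fun z => ?_)
      simp only
      rw [integral_mul_const, mul_assoc, dephasingKernel]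
    · have hF2 : Integrable
          (fun q : ℝ × (ℝ × ℝ) => k q.2 * (conj (g q.2.1) * f q.2.2)) (μ.prod volume) :=
        hF.comp_snd μ
      refine hF2.bdd_mul (c := 1)
        (f := fun q : ℝ × (ℝ × ℝ) => kickPhase ħ q.1 (q.2.1 - q.2.2)) ?_ ?_
      · have : Continuous fun q : ℝ × (ℝ × ℝ) => kickPhase ħ q.1 (q.2.1 - q.2.2) :=
          (continuous_kickPhase_uncurry ħ).comp (by fun_prop : Continuous
            fun q : ℝ × (ℝ × ℝ) => (q.1, q.2.1 - q.2.2))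
        exact this.aestronglyMeasurable
      · exact .of_forall fun q => (norm_kickPhase _ _ _).le

theorem IsHSKernel.integrable_and_l2DephasingLoss_eq {ħ : ℝ} {μ : Measure ℝ}
    [IsProbabilityMeasure μ] {ρ : L2R →L[ℂ] L2R} {k : ℝ × ℝ → ℂ} (hk : IsHSKernel ρ k) :
    Integrable (fun z : ℝ × ℝ =>
        (1 - ‖dephasingKernel ħ μ (z.1 - z.2)‖ ^ 2) * ‖k z‖ ^ 2) volume ∧
      l2DephasingLoss ħ μ ρ =
        ∫ z : ℝ × ℝ, (1 - ‖dephasingKernel ħ μ (z.1 - z.2)‖ ^ 2) * ‖k z‖ ^ 2 := by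
  have hn : ∀ {T : L2R →L[ℂ] L2R} {q : ℝ × ℝ → ℂ}, IsHSKernel T q →
      Integrable (fun z => ‖q z‖ ^ 2) volume ∧ (hsNormSq T).toReal = ∫ z, ‖q z‖ ^ 2 := by
    intro T q hq
    refine ⟨hq.memLp.integrable_norm_pow (by norm_num), ?_⟩
    rw [hq.hsNormSq_eq_lintegral, integral_eq_lintegral_of_nonneg_ae
      (f := fun z => ‖q z‖ ^ 2) (.of_forall fun z => sq_nonneg ‖q z‖) (hq.memLp.1.norm.pow 2)]
    simp_rw [ENNReal.ofReal_pow (norm_nonneg _), ofReal_norm]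
  obtain ⟨h1, h2⟩ := hn hk
  obtain ⟨h3, h4⟩ := hn (hk.dephasing (ħ := ħ) (μ := μ))
  have he : (fun z : ℝ × ℝ => (1 - ‖dephasingKernel ħ μ (z.1 - z.2)‖ ^ 2) * ‖k z‖ ^ 2)
      = fun z => ‖k z‖ ^ 2 - ‖dephasingKernel ħ μ (z.1 - z.2) * k z‖ ^ 2 := by
    funext z
    rw [norm_mul]; ring
  rw [he]
  exact ⟨h1.sub h3, by rw [l2DephasingLoss, h2, h4, integral_sub h1 h3]⟩

theorem IsHSKernel.isHilbertSchmidt {T : L2R →L[ℂ] L2R} {k : ℝ × ℝ → ℂ} (hk : IsHSKernel T k) :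
    IsHilbertSchmidt T := by
  rw [IsHilbertSchmidt, hk.hsNormSq_eq_lintegral, ← sq_eLpNorm_two]
  have := hk.memLp.2
  finiteness

/-! ### Vanishing of the loss -/

/-- The diagonal strip over a countable set is a null set. -/
theorem volume_sub_mem_eq_zero {s : Set ℝ} (hs : s.Countable) :
    ∀ᵐ z : ℝ × ℝ, z.1 - z.2 ∉ s := by
  have hm : MeasurableSet {z : ℝ × ℝ | z.1 - z.2 ∈ s} :=
    (measurable_fst.sub measurable_snd) hs.measurableSet
  have : (volume : Measure (ℝ × ℝ)) {z : ℝ × ℝ | z.1 - z.2 ∈ s} = 0 := by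
    rw [Measure.volume_eq_prod, Measure.measure_prod_null hm]
    -- The fibre over `x` is the countable set `x - s`.
    refine .of_forall fun x => Set.Countable.measure_zero ?_ _
    refine (hs.image fun t => x - t).mono fun y hy => ?_
    exact ⟨x - y, hy, sub_sub_cancel x y⟩
  rw [ae_iff]
  simpa using this

/-- If the dephasing loss vanishes and `|g| < 1` outside a countable set, the operator is zero. -/
theorem IsHSKernel.eq_zero_of_l2DephasingLoss_eq_zero {ħ : ℝ} {μ : Measure ℝ}
    [IsProbabilityMeasure μ] {ρ : L2R →L[ℂ] L2R} {k : ℝ × ℝ → ℂ} (hk : IsHSKernel ρ k)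
    (hμ : {ξ | ‖dephasingKernel ħ μ ξ‖ = 1}.Countable) (h0 : l2DephasingLoss ħ μ ρ = 0) :
    ρ = 0 := by
  obtain ⟨h1, h2⟩ := hk.integrable_and_l2DephasingLoss_eq (ħ := ħ) (μ := μ)
  rw [h0, eq_comm, integral_eq_zero_iff_of_nonneg (fun z => ?_) h1] at h2
  · refine hk.eq_zero ?_
    filter_upwards [h2, volume_sub_mem_eq_zero hμ] with z hz hz2
    rcases mul_eq_zero.1 hz with h | h
    · refine absurd ?_ hz2
      have h3 : ‖dephasingKernel ħ μ (z.1 - z.2)‖ ^ 2 = 1 := by linarith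
      exact (pow_eq_one_iff_of_nonneg (norm_nonneg _) two_ne_zero).1 h3
    · simpa using h
  · have := pow_le_one₀ (n := 2) (norm_nonneg _) (norm_dephasingKernel_le ħ μ (z.1 - z.2))
    exact mul_nonneg (by linarith) (by positivity)

theorem IsHSKernel.l2DephasingLoss_nonneg {ħ : ℝ} {μ : Measure ℝ}
    [IsProbabilityMeasure μ] {ρ : L2R →L[ℂ] L2R} {k : ℝ × ℝ → ℂ} (hk : IsHSKernel ρ k) :
    0 ≤ l2DephasingLoss ħ μ ρ := by
  rw [(hk.integrable_and_l2DephasingLoss_eq (ħ := ħ) (μ := μ)).2]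
  refine integral_nonneg fun z => ?_
  have := pow_le_one₀ (n := 2) (norm_nonneg _) (norm_dephasingKernel_le ħ μ (z.1 - z.2))
  exact mul_nonneg (by linarith) (by positivity)

theorem dephasing_dirac_zero (ħ : ℝ) (ρ : L2R →L[ℂ] L2R) :
    dephasing ħ (Measure.dirac 0) ρ = ρ := by
  have hk : ∀ f, kick ħ 0 f = f := fun f => by
    refine Lp.ext ?_
    filter_upwards [coeFn_kick ħ 0 f] with x hx
    simp [hx, kickPhase]
  ext1 f
  rw [dephasing_apply, integral_dirac, neg_zero, hk, hk]

/-! ### Where `|g| = 1` -/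

/-- A probability measure on the line that is not a point mass has two points in its support. -/
theorem exists_ne_mem_support (μ : Measure ℝ) [IsProbabilityMeasure μ]
    (hμ : ∀ p, μ ≠ Measure.dirac p) : ∃ p ∈ μ.support, ∃ q ∈ μ.support, p ≠ q := by
  obtain ⟨p, hp⟩ := Measure.nonempty_support (IsProbabilityMeasure.ne_zero μ)
  by_contra! h
  refine hμ p ?_
  have hae : ∀ᵐ q ∂μ, q = p := by
    filter_upwards [Measure.support_mem_ae (μ := μ)] with q hq
    exact (h p hp q hq).symm
  calc μ = μ.map id := Measure.map_id.symm
    _ = μ.map fun _ => p := Measure.map_congr hae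
    _ = Measure.dirac p := by simp [Measure.map_const]

/-- Equality case of the triangle inequality: with `c = g(ξ)` of modulus one, the mean of `|exp(i q
ξ / ħ) - c|²` is `2 - 2|c|² = 0`. The phase thus equals `c` for `μ`-almost every `q`, and by
continuity on the whole support. -/
theorem kickPhase_eq_of_norm_eq_one {ħ : ℝ} {μ : Measure ℝ} [IsProbabilityMeasure μ] {ξ : ℝ}
    (h : ‖dephasingKernel ħ μ ξ‖ = 1) {p : ℝ} (hp : p ∈ μ.support) :
    kickPhase ħ p ξ = dephasingKernel ħ μ ξ := by
  set c := dephasingKernel ħ μ ξ with hc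
  have hint : Integrable (fun q => kickPhase ħ q ξ) μ :=
    .of_bound (continuous_kickPhase_left ħ ξ).aestronglyMeasurable 1
      (.of_forall fun q => (norm_kickPhase ħ q ξ).le)
  have hsq : ∀ q, ‖kickPhase ħ q ξ - c‖ ^ 2
      = 2 - 2 * RCLike.re (inner ℂ c (kickPhase ħ q ξ)) := fun q => by
    rw [norm_sub_rev, norm_sub_sq (𝕜 := ℂ), h, norm_kickPhase]; ring
  have hi : Integrable (fun q => RCLike.re (inner ℂ c (kickPhase ħ q ξ))) μ :=
    (hint.const_inner c).re
  have h0 : ∫ q, ‖kickPhase ħ q ξ - c‖ ^ 2 ∂μ = 0 := by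
    simp_rw [hsq]
    rw [integral_sub (integrable_const _) (hi.const_mul 2), integral_const_mul,
      integral_re (hint.const_inner c), integral_inner hint]
    have : ∫ q, kickPhase ħ q ξ ∂μ = c := rfl
    rw [this, inner_self_eq_norm_sq, h]
    simp
  rw [integral_eq_zero_iff_of_nonneg (fun q => by positivity)
    (by simp_rw [hsq]; exact (integrable_const _).sub (hi.const_mul 2))] at h0
  have hcl : IsClosed {q | kickPhase ħ q ξ = c} :=
    isClosed_eq (continuous_kickPhase_left ħ ξ) continuous_const
  refine Measure.support_subset_of_isClosed hcl ?_ hp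
  filter_upwards [h0] with q hq
  simpa [sub_eq_zero] using hq

/-- The set where `|g| = 1` is countable unless the kick is deterministic. -/
theorem countable_norm_dephasingKernel_eq_one {ħ : ℝ} (hħ : 0 < ħ) (μ : Measure ℝ)
    [IsProbabilityMeasure μ] (hμ : ∀ p, μ ≠ Measure.dirac p) :
    {ξ | ‖dephasingKernel ħ μ ξ‖ = 1}.Countable := by
  obtain ⟨p, hp, q, hq, hpq⟩ := exists_ne_mem_support μ hμ
  refine (Set.countable_range fun n : ℤ => n * (2 * Real.pi) * ħ / (p - q)).mono fun ξ hξ => ?_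
  have h := (kickPhase_eq_of_norm_eq_one hξ hp).trans (kickPhase_eq_of_norm_eq_one hξ hq).symm
  rw [kickPhase, kickPhase, Complex.exp_eq_exp_iff_exists_int] at h
  obtain ⟨n, hn⟩ := h
  refine ⟨n, ?_⟩
  have h2 : p * ξ / ħ = q * ξ / ħ + n * (2 * Real.pi) := by
    have := congrArg Complex.im hn
    simpa using this
  have : p - q ≠ 0 := sub_ne_zero.2 hpq
  simp only
  field_simp at h2 ⊢
  linarith

theorem mainTheorem8 (ħ : ℝ) (hħ : 0 < ħ) (μ : Measure ℝ) [IsProbabilityMeasure μ] :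
    -- all quantities are well defined: states are Hilbert-Schmidt, Hilbert-Schmidt operators have
    -- a position kernel, and dephasing preserves the Hilbert-Schmidt class
    (∀ ρ : L2R →L[ℂ] L2R, IsNormalState ρ → IsHilbertSchmidt ρ) ∧
    (∀ ρ : L2R →L[ℂ] L2R, IsHilbertSchmidt ρ →
      IsHilbertSchmidt (dephasing ħ μ ρ) ∧ ∃ k : ℝ × ℝ → ℂ, IsHSKernel ρ k) ∧
    -- the integral formula
    (∀ ρ : L2R →L[ℂ] L2R, IsHilbertSchmidt ρ → ∀ k : ℝ × ℝ → ℂ, IsHSKernel ρ k →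
      Integrable (fun z : ℝ × ℝ =>
        (1 - ‖dephasingKernel ħ μ (z.1 - z.2)‖ ^ 2) * ‖k z‖ ^ 2) volume ∧
      l2DephasingLoss ħ μ ρ =
        ∫ z : ℝ × ℝ, (1 - ‖dephasingKernel ħ μ (z.1 - z.2)‖ ^ 2) * ‖k z‖ ^ 2) ∧
    -- faithfulness, unless the kick is deterministic and nonzero
    ((∀ p : ℝ, p ≠ 0 → μ ≠ Measure.dirac p) → ∀ ρ : L2R →L[ℂ] L2R, IsHilbertSchmidt ρ →
      (l2DephasingLoss ħ μ ρ = 0 ↔ dephasing ħ μ ρ = ρ)) ∧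
    -- strict positivity on normal states
    ((∀ ξ : ℝ, ξ ≠ 0 → ‖dephasingKernel ħ μ ξ‖ < 1) → ∀ ρ : L2R →L[ℂ] L2R, IsNormalState ρ →
      0 < l2DephasingLoss ħ μ ρ) := by
  refine ⟨fun ρ hρ => hρ.isHilbertSchmidt, fun ρ hρ => ?_,
    fun ρ _ k hk => hk.integrable_and_l2DephasingLoss_eq, fun hμ ρ hρ => ?_, fun hg ρ hρ => ?_⟩
  · obtain ⟨k, hk⟩ := hρ.exists_isHSKernel
    exact ⟨hk.dephasing.isHilbertSchmidt, k, hk⟩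
  · refine ⟨fun h0 => ?_, fun h => by rw [l2DephasingLoss, h, sub_self]⟩
    -- At the point mass at `0` the loss gives no information, but the channel is the identity; in
    -- every other case zero loss forces `ρ = 0`.
    by_cases hd : μ = Measure.dirac 0
    · subst hd
      exact dephasing_dirac_zero ħ ρ
    · obtain ⟨k, hk⟩ := hρ.exists_isHSKernel
      have hz : ρ = 0 := by
        refine hk.eq_zero_of_l2DephasingLoss_eq_zero
          (countable_norm_dephasingKernel_eq_one hħ μ fun p => ?_) h0
        by_cases hp : p = 0
        · rwa [hp]
        · exact hμ p hp
      ext1 f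
      simp [hz, dephasing_apply]
  · obtain ⟨k, hk⟩ := hρ.isHilbertSchmidt.exists_isHSKernel
    refine lt_of_le_of_ne hk.l2DephasingLoss_nonneg fun h0 => hρ.ne_zero ?_
    refine hk.eq_zero_of_l2DephasingLoss_eq_zero ?_ h0.symm
    refine (Set.countable_singleton (0 : ℝ)).mono fun ξ hξ => ?_
    by_contra hne
    exact (hg ξ hne).ne hξ
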